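/- Let $M$ be a von Neumann algebra on a complex Hilbert space, with predual $A=M_*$, state space $S(M)$ and set of normal states $S_*(M)=S(M)\cap M_*$. Let $G$ be a (Hausdorff) locally compact group with left Haar measure $\lambda$, acting on $M$: $x\mapsto\alpha_x$ is a homomorphism from $G$ into the group of $*$-automorphisms of $M$ such that $x\mapsto\alpha_x(m)$ is weak$^*$-continuous for each $m\in M$. Put $\beta_x=(\alpha_{x^{-1}})_*: A\to A$. Assume: (a) $A$, with its norm as the predual of $M$, carries a multiplication making it a (complex, associative) Banach algebra; (b) each $\beta_x$ is an algebra automorphism of $A$; (c) $A$ has a two-sided bounded approximate identity $\{e_\delta\}$; (d) the action $\beta$ is inner on $A$: there is given a strictly continuous homomorphism $\gamma$ from $G$ into the invertible group of the multiplier algebra of $A$ with $\|\gamma(x)\|\le 1$ and $\beta_x(a)=\gamma(x)\,a\,\gamma(x)^{-1}$ for all $x\in G$, $a\in A$. A left Banach $A$-module is a Banach space $X$ that is a left $A$-module with $\|a\xi\|\le\|a\|\|\xi\|$; it is essential if every $\xi\in X$ has the form $a\eta$ with $a\in A$, $\eta\in X$. On such an essential $X$ the group $G$ acts by the bounded operators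 $x\xi=\lim_\delta(\gamma(x)e_\delta)\xi$. Let $X$ be a left Banach $A$-module on which $G$ also acts by bounded operators. Let $T_a,T_x\in B(X^{**})$ be the second adjoints of the actions of $a\in A$ and $x\in G$ on $X$, and let $P_X$ be the closure of $\{T_a: a\in S_*(M)\}$ in $B(X^{**})$ for the weak$^*$ topology given by $B(X^{**})=(X^{**}\widehat\otimes X^*)^*$. We say that $X$ has a $G$–$A$-fixed point if there is $T_0\in P_X$ with $T_xT_0T_{x^{-1}}=T_0$ for all $x\in G$. Then the following statements are equivalent: (i) $M$ is $G$-amenable, i.e. there is $p\in S(M)$ with $p\circ\alpha_{x^{-1}}=p$ for all $x\in G$; (ii) $A$ has the $G$-fixed point property for essential left Banach $A$-modules, i.e. every essential left Banach $A$-module $X$, with the above action of $G$, has a $G$–$A$-fixed point; (iii) $A$, with left multiplication by $A$ and with the action $xa=\gamma(x)a$ of $G$, has a $G$–$A$-fixed point; (iv) $L^1(G,A)$ (the completion of $C_c(G,A)$ in the norm $\int\|f(t)\|\,d\lambda(t)$), with $(af)(t)=a\,f(t)$ and $(xf)(t)=\beta_x(f(x^{-1}t))$, has a $G$–$A$-fixed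 point. -/

import Mathlib

open Filter Topology MeasureTheory
open scoped ComplexOrder MultiplierAlgebra

namespace VNAmenability

noncomputable section

/-! ### Von Neumann algebras: predual, states, automorphisms -/

section VonNeumann

variable {H : Type*} [NormedAddCommGroup H] [InnerProductSpace ℂ H] [CompleteSpace H]

/-- The vector functional `m ↦ ⟪η, m ξ⟫` on `M`. -/
def vectorFunctional (M : VonNeumannAlgebra H) (ξ η : H) :
    StrongDual ℂ M.toStarSubalgebra :=
  LinearMap.mkContinuous
    { toFun := fun m => inner ℂ η ((m : H →L[ℂ] H) ξ)
      map_add' := fun m n => by simp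
      map_smul' := fun c m => by simp }
    (‖η‖ * ‖ξ‖) (fun m => by
      refine (norm_inner_le_norm _ _).trans ?_
      have h := (m : H →L[ℂ] H).le_opNorm ξ
      have h2 : ‖(m : H →L[ℂ] H)‖ = ‖m‖ := rfl
      calc ‖η‖ * ‖(m : H →L[ℂ] H) ξ‖ ≤ ‖η‖ * (‖(m : H →L[ℂ] H)‖ * ‖ξ‖) := by gcongr
        _ = ‖η‖ * ‖ξ‖ * ‖m‖ := by rw [h2]; ring)

/-- The predual `M_*`: the ultraweakly continuous functionals on `M`, that is, the norm closure
in `M^*` of the linear span of the vector functionals. -/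
def Predual (M : VonNeumannAlgebra H) : Submodule ℂ (StrongDual ℂ M.toStarSubalgebra) :=
  (Submodule.span ℂ
    {ω | ∃ ξ η : H, ω = vectorFunctional M ξ η}).topologicalClosure

/-- `S(M)`: positive functionals taking the value `1` at the identity. Positivity of `m` is
positivity as an operator on `H`. -/
def IsState (M : VonNeumannAlgebra H) (p : StrongDual ℂ M.toStarSubalgebra) : Prop :=
  (∀ m : M.toStarSubalgebra, 0 ≤ (m : H →L[ℂ] H) → 0 ≤ p m) ∧ p 1 = 1

/-- `α` is an action of the topological group `G` on `M`: for every `m`, the map `x ↦ α_x(m)` is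
continuous from `G` into `M` with the weak* topology `σ(M, M_*)`. -/
def IsWeakStarContinuousAction (M : VonNeumannAlgebra H) {G : Type*} [Group G]
    [TopologicalSpace G] (α : G →* (M.toStarSubalgebra ≃⋆ₐ[ℂ] M.toStarSubalgebra)) : Prop :=
  ∀ m : M.toStarSubalgebra, ∀ ω ∈ Predual M, Continuous fun x => ω (α x m)

/-- `M` is `G`-amenable: there is a state `p` with `(α_{x⁻¹})^* p = p` for all `x`. -/
def IsGAmenable (M : VonNeumannAlgebra H) {G : Type*} [Group G]
    (α : G →* (M.toStarSubalgebra ≃⋆ₐ[ℂ] M.toStarSubalgebra)) : Prop :=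
  ∃ p : StrongDual ℂ M.toStarSubalgebra, IsState M p ∧ ∀ x m, p (α x⁻¹ m) = p m

variable {M : VonNeumannAlgebra H}
variable {A : Type*} [NonUnitalNormedRing A] [NormedSpace ℂ A]

open Classical in
/-- The preadjoint `θ_*` of a `*`-automorphism `θ` of `M`, on a Banach space `A` identified with
`M_*` through `j`: the operator with `⟨m, θ_* a⟩ = ⟨θ m, a⟩`. (Automorphisms of von Neumann
algebras are normal, so it exists, and it is clearly unique; the value `0` is a formal default.) -/
def preadjoint (j : A ≃ₗᵢ[ℂ] Predual M)
    (θ : M.toStarSubalgebra ≃⋆ₐ[ℂ] M.toStarSubalgebra) : A →L[ℂ] A :=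
  if h : ∃ B : A →L[ℂ] A, ∀ a m,
      (j (B a) : StrongDual ℂ M.toStarSubalgebra) m
        = (j a : StrongDual ℂ M.toStarSubalgebra) (θ m)
  then h.choose else 0

/-- `β_x = (α_{x⁻¹})_*` on `A = M_*`. -/
def predualAction (j : A ≃ₗᵢ[ℂ] Predual M) {G : Type*} [Group G]
    (α : G →* (M.toStarSubalgebra ≃⋆ₐ[ℂ] M.toStarSubalgebra)) (x : G) : A →L[ℂ] A :=
  preadjoint j (α x⁻¹)

/-- `S_*(M)`, as a subset of `A = M_*`. -/
def normalStates (j : A ≃ₗᵢ[ℂ] Predual M) : Set A :=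
  {a | IsState M (j a : StrongDual ℂ M.toStarSubalgebra)}

end VonNeumann

/-! ### Left Banach modules -/

/-- A left Banach `A`-module structure on the Banach space `X`. -/
structure LeftBanachModule (A X : Type*) [NonUnitalNormedRing A] [NormedSpace ℂ A]
    [NormedAddCommGroup X] [NormedSpace ℂ X] where
  act : A →L[ℂ] X →L[ℂ] X
  act_mul : ∀ a b ξ, act (a * b) ξ = act a (act b ξ)
  norm_act_le : ∀ a ξ, ‖act a ξ‖ ≤ ‖a‖ * ‖ξ‖

section Modules

variable {A : Type*} [NonUnitalNormedRing A] [NormedSpace ℂ A]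
variable {X : Type*} [NormedAddCommGroup X] [NormedSpace ℂ X]

/-- Every `ξ ∈ X` is of the form `a η`. -/
def LeftBanachModule.IsEssential (π : LeftBanachModule A X) : Prop :=
  ∀ ξ : X, ∃ (a : A) (η : X), π.act a η = ξ

/-- `l` is a (two-sided) bounded approximate identity of `A`; a net `(e_δ)` corresponds to the
filter generated by its tails. -/
def IsBoundedApproxIdentity (l : Filter A) : Prop :=
  l.IsApproximateUnit ∧ ∃ C : ℝ, ∀ᶠ e in l, ‖e‖ ≤ C

variable [IsScalarTower ℂ A A] [SMulCommClass ℂ A A]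

/-- `A` as a left module over itself by left multiplication. -/
def selfModule (A : Type*) [NonUnitalNormedRing A] [NormedSpace ℂ A]
    [IsScalarTower ℂ A A] [SMulCommClass ℂ A A] : LeftBanachModule A A where
  act := ContinuousLinearMap.mul ℂ A
  act_mul a b ξ := by simp [mul_assoc]
  norm_act_le a ξ := by simpa using norm_mul_le a ξ

/-- With an approximate identity, the left part of a multiplier is a right module map. -/
theorem fst_mul {l : Filter A} (hl : IsBoundedApproxIdentity l) (c : 𝓜(ℂ, A)) (a b : A) :
    c.fst (a * b) = c.fst a * b := by
  have := hl.1.neBot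
  have key : ∀ z : A, z * c.fst (a * b) = z * (c.fst a * b) := fun z => by
    rw [← c.central, ← mul_assoc, c.central, mul_assoc]
  have h1 := hl.1.tendsto_mul_right (c.fst (a * b))
  have h2 := hl.1.tendsto_mul_right (c.fst a * b)
  simp only [key] at h1
  exact tendsto_nhds_unique h1 h2

theorem tendsto_multiplier {l : Filter A} (hl : IsBoundedApproxIdentity l)
    (π : LeftBanachModule A X) (c : 𝓜(ℂ, A)) (a : A) (η : X) :
    Tendsto (fun e => π.act (c.fst e) (π.act a η)) l (𝓝 (π.act (c.fst a) η)) := by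
  have h : Continuous fun b : A => π.act (c.fst b) η := by fun_prop
  have h2 := (h.tendsto a).comp (hl.1.tendsto_mul_right a)
  refine h2.congr fun e => ?_
  simp only [Function.comp]
  rw [fst_mul hl, π.act_mul]

theorem tendsto_limUnder_multiplier {l : Filter A} (hl : IsBoundedApproxIdentity l)
    {π : LeftBanachModule A X} (hπ : π.IsEssential) (c : 𝓜(ℂ, A)) (ξ : X) :
    Tendsto (fun e => π.act (c.fst e) ξ) l (𝓝 (limUnder l fun e => π.act (c.fst e) ξ)) := by
  obtain ⟨a, η, rfl⟩ := hπ ξ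
  exact tendsto_nhds_limUnder ⟨_, tendsto_multiplier hl π c a η⟩

/-- The operator `ξ ↦ c ξ = lim_δ (c e_δ) ξ` by which a multiplier `c` of `A` acts on an
essential left Banach `A`-module. -/
def multiplierAct {l : Filter A} (hl : IsBoundedApproxIdentity l)
    {π : LeftBanachModule A X} (hπ : π.IsEssential) (c : 𝓜(ℂ, A)) : X →L[ℂ] X :=
  haveI := hl.1.neBot
  LinearMap.mkContinuousOfExistsBound
    { toFun := fun ξ => limUnder l fun e => π.act (c.fst e) ξ
      map_add' := fun ξ η => by
        refine tendsto_nhds_unique (tendsto_limUnder_multiplier hl hπ c (ξ + η)) ?_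
        simpa using (tendsto_limUnder_multiplier hl hπ c ξ).add
          (tendsto_limUnder_multiplier hl hπ c η)
      map_smul' := fun r ξ => by
        refine tendsto_nhds_unique (tendsto_limUnder_multiplier hl hπ c (r • ξ)) ?_
        simpa using (tendsto_limUnder_multiplier hl hπ c ξ).const_smul r }
    (by
      obtain ⟨C, hC⟩ := hl.2
      refine ⟨‖c.fst‖ * C, fun ξ => ?_⟩
      refine le_of_tendsto (tendsto_limUnder_multiplier hl hπ c ξ).norm ?_
      filter_upwards [hC] with e he
      calc ‖π.act (c.fst e) ξ‖ ≤ ‖c.fst e‖ * ‖ξ‖ := π.norm_act_le _ _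
        _ ≤ (‖c.fst‖ * ‖e‖) * ‖ξ‖ := by gcongr; exact c.fst.le_opNorm e
        _ ≤ ‖c.fst‖ * C * ‖ξ‖ := by gcongr)

end Modules

/-! ### The covariant space `L¹(G, A)` as a module -/

section Covariant

variable {A : Type*} [NonUnitalNormedRing A] [NormedSpace ℂ A]
  [IsScalarTower ℂ A A] [SMulCommClass ℂ A A]
variable {G : Type*} [MeasurableSpace G] (μ : Measure G)

/-- The left `A`-module `L¹(G, A)` with `(a f)(t) = a (f t)`. The completion of `C_c(G, A)` in the
norm `∫ ‖f‖` is realized as the space of Bochner integrable functions modulo null functions. -/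
def covariantModule : LeftBanachModule A (Lp A 1 μ) where
  act := (ContinuousLinearMap.mul ℂ A).compLpL₂ 1 μ
  act_mul a b f := by
    simp only [ContinuousLinearMap.compLpL₂_apply_apply]
    apply Lp.ext
    filter_upwards [ContinuousLinearMap.coeFn_compLp (ContinuousLinearMap.mul ℂ A (a * b)) f,
      ContinuousLinearMap.coeFn_compLp (ContinuousLinearMap.mul ℂ A a)
        ((ContinuousLinearMap.mul ℂ A b).compLp f),
      ContinuousLinearMap.coeFn_compLp (ContinuousLinearMap.mul ℂ A b) f] with t h1 h2 h3
    rw [h1, h2, h3]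
    simp [mul_assoc]
  norm_act_le a f := by
    simp only [ContinuousLinearMap.compLpL₂_apply_apply]
    refine (ContinuousLinearMap.norm_compLp_le _ f).trans ?_
    gcongr
    exact ContinuousLinearMap.opNorm_mul_apply_le ℂ A a

variable [Group G] [TopologicalSpace G] [IsTopologicalGroup G] [BorelSpace G]

/-- The operators `(x f)(t) = β_x(f(x⁻¹ t))` on `L¹(G, A)`. -/
def covariantAct [μ.IsMulLeftInvariant] (β : G → A →L[ℂ] A) (x : G) :
    Lp A 1 μ →L[ℂ] Lp A 1 μ :=
  (β x).compLpL 1 μ ∘L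
    (Lp.compMeasurePreservingₗᵢ ℂ (fun t : G => x⁻¹ * t)
      (measurePreserving_mul_left μ x⁻¹)).toContinuousLinearMap

end Covariant

/-! ### Fixed points -/

section FixedPoint

/-- The Banach space bidual `X^{**}`. -/
abbrev Bidual (X : Type*) [NormedAddCommGroup X] [NormedSpace ℂ X] : Type _ :=
  StrongDual ℂ (StrongDual ℂ X)

/-- The second adjoint `S^{**}`, given by `(S^{**} m)(f) = m(f ∘ S)`. -/
def bidualMap {X : Type*} [NormedAddCommGroup X] [NormedSpace ℂ X] (S : X →L[ℂ] X) :
    Bidual X →L[ℂ] Bidual X :=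
  ContinuousLinearMap.precomp ℂ
    (ContinuousLinearMap.precomp ℂ S : StrongDual ℂ X →L[ℂ] StrongDual ℂ X)

/-- The weak* topology of `B(X^{**}) = (X^{**} ⊗̂ X^*)^*`. The elements of the projective tensor
product are the series `∑ mₙ ⊗ wₙ` with `∑ ‖mₙ‖ ‖wₙ‖ < ∞`, and such an element is paired with `T`
to `∑ ⟨T mₙ, wₙ⟩`. -/
abbrev weakStarTopology (X : Type*) [NormedAddCommGroup X] [NormedSpace ℂ X] :
    TopologicalSpace (Bidual X →L[ℂ] Bidual X) :=
  ⨅ (m : ℕ → Bidual X) (w : ℕ → StrongDual ℂ X) (_ : Summable fun n => ‖m n‖ * ‖w n‖),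
    TopologicalSpace.induced (fun T => ∑' n, T (m n) (w n)) inferInstance

variable {H : Type*} [NormedAddCommGroup H] [InnerProductSpace ℂ H] [CompleteSpace H]
  {M : VonNeumannAlgebra H}
  {A : Type*} [NonUnitalNormedRing A] [NormedSpace ℂ A]
  {X : Type*} [NormedAddCommGroup X] [NormedSpace ℂ X]

/-- `P_X`: the weak* closure in `B(X^{**})` of the operators `T_a`, `a ∈ S_*(M)`, where
`T_a` is the second adjoint of the action of `a` on `X`. -/
def fixedPointSet (j : A ≃ₗᵢ[ℂ] Predual M) (π : LeftBanachModule A X) :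
    Set (Bidual X →L[ℂ] Bidual X) :=
  closure[weakStarTopology X] ((fun a => bidualMap (π.act a)) '' normalStates j)

/-- `X`, on which `A` acts by `π` and `G` by the operators `ρ x`, has a `G`–`A`-fixed point:
some `T₀ ∈ P_X` satisfies `T_x T₀ T_{x⁻¹} = T₀` for all `x ∈ G`. -/
def HasFixedPoint (j : A ≃ₗᵢ[ℂ] Predual M) (π : LeftBanachModule A X)
    {G : Type*} [Group G] (ρ : G → X →L[ℂ] X) : Prop :=
  ∃ T₀ ∈ fixedPointSet j π, ∀ x : G,
    bidualMap (ρ x) ∘L T₀ ∘L bidualMap (ρ x⁻¹) = T₀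

end FixedPoint

/-- `γ` is a strictly continuous homomorphism of `G` into the multipliers of norm at most `1`, and
`β_x(a) = γ(x) a γ(x)⁻¹`. (For a multiplier `c`, `c a` is `c.fst a` and `a c` is `c.snd a`.) -/
structure IsInnerVia {A : Type*} [NonUnitalNormedRing A] [NormedSpace ℂ A]
    [IsScalarTower ℂ A A] [SMulCommClass ℂ A A] {G : Type*} [Group G] [TopologicalSpace G]
    (β : G → A →L[ℂ] A) (γ : G →* 𝓜(ℂ, A)) : Prop where
  norm_le : ∀ x, ‖γ x‖ ≤ 1
  continuous_left : ∀ a : A, Continuous fun x => (γ x).fst a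
  continuous_right : ∀ a : A, Continuous fun x => (γ x).snd a
  eq_conj : ∀ x a, β x a = (γ x).fst ((γ x⁻¹).snd a)

end

end VNAmenability

universe u v w z

namespace VNAmenability

/-! ### Vector functionals, duality between `M` and its predual, bounds for states. -/

section VonNeumann

variable {H : Type*} [NormedAddCommGroup H] [InnerProductSpace ℂ H] [CompleteSpace H]

/-! For a module `X`, each pair `m ∈ X**`, `w ∈ X*` has a coefficient functional `a ↦ ⟨T_a m, w⟩` in
`A* = M`. Hence every `p ∈ A** = M*` defines an operator `T_p` on `X**` by pairing `p` with
coefficients. Normal states are bounded and weak* dense in `S(M)`, so `P_X` consists exactly of the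
`T_p` with `p` a state.

All three module structures satisfy `ρ_x T_a ρ_{x⁻¹} = T_{β_x a}`. Conjugating `T_p` therefore
replaces a coefficient `n ∈ M` by `α_{x⁻¹} n`. An invariant state gives a fixed point on any such
module (`hasFixedPoint_of_isGAmenable`). Conversely, a fixed point gives a state invariant on the
coefficients of `X`, and this suffices if they exhaust `M` (`isGAmenable_of_hasFixedPoint`).

They do when `A` is a retract of `X` (`exists_coefficient_eq`): if `E` is a weak* cluster point of
the approximate identity, the pair `(E, Φ)` on `A` has coefficient `a ↦ lim Φ(a e) = Φ(a)`. For
`L¹(G, A)` the retraction is integration. For essential modules one tests on `A` itself, which is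
essential by Cohen factorization. Every equivalence thus passes through (i). -/

@[simp]
theorem vectorFunctional_apply (M : VonNeumannAlgebra H) (ξ η : H) (m : M.toStarSubalgebra) :
    vectorFunctional M ξ η m = inner ℂ η ((m : H →L[ℂ] H) ξ) := rfl

theorem norm_vectorFunctional_le (M : VonNeumannAlgebra H) (ξ η : H) :
    ‖vectorFunctional M ξ η‖ ≤ ‖η‖ * ‖ξ‖ :=
  LinearMap.mkContinuous_norm_le _ (by positivity) _

theorem vectorFunctional_mem_predual (M : VonNeumannAlgebra H) (ξ η : H) :
    vectorFunctional M ξ η ∈ Predual M :=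
  Submodule.le_topologicalClosure _ (Submodule.subset_span ⟨ξ, η, rfl⟩)

variable {M : VonNeumannAlgebra H}

/-- The vector functional `m ↦ ⟪η, m ξ⟫` as an element of a Banach space identified with `M_*`. -/
noncomputable def vectorElement {E : Type*} [NormedAddCommGroup E] [NormedSpace ℂ E]
    (j : E ≃ₗᵢ[ℂ] Predual M) (ξ η : H) : E :=
  j.symm ⟨vectorFunctional M ξ η, vectorFunctional_mem_predual M ξ η⟩

section Dual

variable {E : Type*} [NormedAddCommGroup E] [NormedSpace ℂ E] (j : E ≃ₗᵢ[ℂ] Predual M)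

@[simp]
theorem apply_vectorElement (ξ η : H) (m : M.toStarSubalgebra) :
    (j (vectorElement j ξ η) : StrongDual ℂ M.toStarSubalgebra) m
      = inner ℂ η ((m : H →L[ℂ] H) ξ) := by
  simp [vectorElement]

theorem norm_vectorElement_le (ξ η : H) : ‖vectorElement j ξ η‖ ≤ ‖η‖ * ‖ξ‖ :=
  (j.symm.norm_map _).trans_le (norm_vectorFunctional_le M ξ η)

theorem predual_ext {a b : E} (h : ∀ m, (j a : StrongDual ℂ M.toStarSubalgebra) m
    = (j b : StrongDual ℂ M.toStarSubalgebra) m) : a = b :=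
  j.injective (Subtype.ext (ContinuousLinearMap.ext h))

theorem closure_span_vectorElement :
    (Submodule.span ℂ {a | ∃ ξ η, a = vectorElement j ξ η}).topologicalClosure = ⊤ := by
  rw [eq_top_iff]
  intro a _
  let S := Submodule.span ℂ {a | ∃ ξ η, a = vectorElement j ξ η}
  have key : ∀ ω ∈ Submodule.span ℂ {ω | ∃ ξ η : H, ω = vectorFunctional M ξ η},
      ∃ b ∈ S, (j b : StrongDual ℂ M.toStarSubalgebra) = ω := by
    intro ω h
    induction h using Submodule.span_induction with
    | mem ω h =>
      obtain ⟨ξ, η, rfl⟩ := h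
      exact ⟨_, Submodule.subset_span ⟨ξ, η, rfl⟩, by simp [vectorElement]⟩
    | zero => exact ⟨0, S.zero_mem, by rw [j.map_zero]; rfl⟩
    | add x y _ _ h1 h2 =>
      obtain ⟨b, hb, rfl⟩ := h1
      obtain ⟨c, hc, rfl⟩ := h2
      exact ⟨b + c, S.add_mem hb hc, by simp⟩
    | smul c x _ h1 =>
      obtain ⟨b, hb, rfl⟩ := h1
      exact ⟨c • b, S.smul_mem c hb, by simp⟩
  obtain ⟨u, hu, hlim⟩ := mem_closure_iff_seq_limit.1 (j a).2
  choose b hb hbu using fun n => key (u n) (hu n)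
  refine mem_closure_iff_seq_limit.2 ⟨b, hb, ?_⟩
  rw [j.isometry.isEmbedding.tendsto_nhds_iff, tendsto_subtype_rng]
  exact hlim.congr fun n => (hbu n).symm

/-- A von Neumann algebra is the dual of its predual. -/
theorem exists_forall_predual_apply_eq (Φ : StrongDual ℂ E) :
    ∃ m : M.toStarSubalgebra, ∀ a, Φ a = (j a : StrongDual ℂ M.toStarSubalgebra) m := by
  -- `Φ` evaluated on vector functionals is a bounded sesquilinear form, hence is given by an
  -- operator `T`.
  let B : H →L⋆[ℂ] H →L[ℂ] ℂ := LinearMap.mkContinuous₂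
    (LinearMap.mk₂'ₛₗ (starRingEnd ℂ) (RingHom.id ℂ) (fun η ξ => Φ (vectorElement j ξ η))
      (fun η η' ξ => by
        rw [← map_add]; congr 1
        exact predual_ext j fun m => by simp)
      (fun c η ξ => by
        rw [← map_smul]; congr 1
        exact predual_ext j fun m => by simp [mul_comm])
      (fun η ξ ξ' => by
        rw [← map_add]; congr 1
        exact predual_ext j fun m => by simp)
      (fun c η ξ => by
        rw [RingHom.id_apply, ← map_smul]; congr 1
        exact predual_ext j fun m => by simp)) ‖Φ‖
    (fun η ξ => by
      refine (Φ.le_opNorm _).trans ?_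
      rw [mul_assoc]
      gcongr
      exact norm_vectorElement_le j ξ η)
  let T : H →L[ℂ] H :=
    ContinuousLinearMap.adjoint (InnerProductSpace.continuousLinearMapOfBilin B)
  have hT : ∀ η ξ, inner ℂ η (T ξ) = Φ (vectorElement j ξ η) := fun η ξ => by
    rw [ContinuousLinearMap.adjoint_inner_right,
      InnerProductSpace.continuousLinearMapOfBilin_apply]
    rfl
  have hTM : T ∈ M.toStarSubalgebra := by
    change T ∈ (M : Set (H →L[ℂ] H))
    -- Double commutant: for `u` in the commutant, the functionals of `(u ξ, η)` and `(ξ, u* η)`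
    -- agree on `M`, which forces `u T = T u`.
    rw [← M.centralizer_centralizer]
    intro u hu
    ext ξ
    refine ext_inner_left ℂ fun η => ?_
    have h1 : inner ℂ η ((u * T) ξ) = inner ℂ (ContinuousLinearMap.adjoint u η) (T ξ) := by
      rw [ContinuousLinearMap.adjoint_inner_left]; rfl
    have h2 : inner ℂ η ((T * u) ξ) = inner ℂ η (T (u ξ)) := rfl
    rw [h1, h2, hT, hT]
    congr 1
    refine predual_ext j fun m => ?_
    have h3 : (m : H →L[ℂ] H) (u ξ) = u ((m : H →L[ℂ] H) ξ) :=
      congrArg (fun S : H →L[ℂ] H => S ξ) (hu m m.2)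
    simp [ContinuousLinearMap.adjoint_inner_left, h3]
  refine ⟨⟨T, hTM⟩, fun a => ?_⟩
  let Ψ : E →L[ℂ] ℂ := (ContinuousLinearMap.apply ℂ ℂ (⟨T, hTM⟩ : M.toStarSubalgebra)) ∘L
    (Predual M).subtypeL ∘L j.toContinuousLinearEquiv.toContinuousLinearMap
  have : Φ = Ψ := ContinuousLinearMap.ext_on
    (s := {a | ∃ ξ η, a = vectorElement j ξ η})
    ((Submodule.dense_iff_topologicalClosure_eq_top).2 (closure_span_vectorElement j)) (by
      rintro _ ⟨ξ, η, rfl⟩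
      rw [← hT]
      exact (apply_vectorElement j ξ η ⟨T, hTM⟩).symm)
  exact congrArg (fun F : StrongDual ℂ E => F a) this

end Dual

theorem coe_algebraMap_real (r : ℝ) :
    ((algebraMap ℝ M.toStarSubalgebra r : M.toStarSubalgebra) : H →L[ℂ] H)
      = algebraMap ℝ (H →L[ℂ] H) r := rfl

theorem IsState.apply_algebraMap {p : StrongDual ℂ M.toStarSubalgebra} (hp : IsState M p) (r : ℝ) :
    p (algebraMap ℝ M.toStarSubalgebra r) = r := by
  have : algebraMap ℝ M.toStarSubalgebra r = (r : ℂ) • 1 := by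
    rw [Algebra.algebraMap_eq_smul_one]; rfl
  rw [this, map_smul, hp.2]; simp

theorem IsState.apply_le {p : StrongDual ℂ M.toStarSubalgebra} (hp : IsState M p)
    {m : M.toStarSubalgebra} {r : ℝ} (h : (m : H →L[ℂ] H) ≤ algebraMap ℝ _ r) : p m ≤ r := by
  have := hp.1 (algebraMap ℝ _ r - m) (by simpa [coe_algebraMap_real] using h)
  rwa [map_sub, hp.apply_algebraMap, sub_nonneg] at this

theorem IsState.abs_re_le {p : StrongDual ℂ M.toStarSubalgebra} (hp : IsState M p)
    {m : M.toStarSubalgebra} (hm : IsSelfAdjoint m) : (p m).im = 0 ∧ |(p m).re| ≤ ‖m‖ := by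
  have hm' : IsSelfAdjoint (m : H →L[ℂ] H) := congrArg Subtype.val hm
  have h1 := hp.apply_le (r := ‖m‖) hm'.le_algebraMap_norm_self
  have h2 := hp.apply_le (m := -m) (r := ‖m‖) (hm'.neg.le_algebraMap_norm_self.trans_eq (by
    rw [norm_neg]; rfl))
  rw [Complex.le_def] at h1 h2
  simp only [map_neg, Complex.neg_re, Complex.ofReal_re, Complex.ofReal_im] at h1 h2
  exact ⟨h1.2, abs_le.2 ⟨by linarith, h1.1⟩⟩

-- A state is real on self-adjoint elements, so `I` times the imaginary part contributes nothing to
-- the real part.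
open ComplexStarModule in
theorem IsState.re_apply {p : StrongDual ℂ M.toStarSubalgebra} (hp : IsState M p)
    (m : M.toStarSubalgebra) : (p m).re = (p (realPart m : M.toStarSubalgebra)).re := by
  conv_lhs => rw [← realPart_add_I_smul_imaginaryPart m]
  have h := (hp.abs_re_le (imaginaryPart m).2).1
  simp [h]

/-- Splitting into real and imaginary parts costs a factor 2 over the sharp constant 1; any uniform
bound serves for compactness. -/
theorem IsState.norm_le {p : StrongDual ℂ M.toStarSubalgebra} (hp : IsState M p) : ‖p‖ ≤ 2 := by
  refine p.opNorm_le_bound (by norm_num) fun m => ?_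
  have h : ∀ n : selfAdjoint M.toStarSubalgebra, ‖p n‖ ≤ ‖n‖ := fun n => by
    obtain ⟨h1, h2⟩ := hp.abs_re_le n.2
    calc ‖p n‖ ≤ |(p n).re| + |(p n).im| := Complex.norm_le_abs_re_add_abs_im _
      _ ≤ ‖n‖ := by rw [h1]; simpa using h2
  conv_lhs => rw [← realPart_add_I_smul_imaginaryPart m]
  rw [map_add, map_smul]
  calc _ ≤ ‖p (realPart m : M.toStarSubalgebra)‖ +
          ‖Complex.I • p (imaginaryPart m : M.toStarSubalgebra)‖ :=
        norm_add_le _ _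
    _ ≤ ‖m‖ + ‖m‖ := by
        rw [norm_smul, Complex.norm_I, one_mul]
        gcongr
        · exact (h _).trans (realPart.norm_le m)
        · exact (h _).trans (imaginaryPart.norm_le m)
    _ = 2 * ‖m‖ := by ring

end VonNeumann

/-! ### Filters, weak* compactness and weak* separation. -/

section Topology

/-- Keeping the filter on the source allows it to be refined later so that a second map, here into
`A**`, converges along it too. -/
theorem exists_filter_of_mem_closure_image {Y Z : Type*} [TopologicalSpace Z] {f : Y → Z}
    {s : Set Y} {z : Z} (h : z ∈ closure (f '' s)) :
    ∃ F : Filter Y, F.NeBot ∧ s ∈ F ∧ Tendsto f F (𝓝 z) := by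
  have h1 : ∃ᶠ y in comap f (𝓝 z), y ∈ s := by
    rw [frequently_comap]
    exact (mem_closure_iff_frequently.1 h).mono fun b ⟨a, ha, hab⟩ => ⟨a, hab, ha⟩
  exact ⟨comap f (𝓝 z) ⊓ 𝓟 s, frequently_mem_iff_neBot.1 h1,
    mem_inf_of_right (mem_principal_self s), tendsto_comap.mono_left inf_le_left⟩

/-- Bounded nets have weak* cluster points in the bidual. -/
theorem exists_ultrafilter_tendsto_bidual {E : Type*} [NormedAddCommGroup E] [NormedSpace ℂ E]
    (l : Filter E) [l.NeBot] {C : ℝ} (hC : ∀ᶠ e in l, ‖e‖ ≤ C) :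
    ∃ (U : Ultrafilter E) (p : Bidual E), ↑U ≤ l ∧
      ∀ Φ : StrongDual ℂ E, Tendsto (fun e => Φ e) U (𝓝 (p Φ)) := by
  obtain ⟨U, hU⟩ := Ultrafilter.exists_le l
  let ι : E → WeakDual ℂ (StrongDual ℂ E) := fun e =>
    StrongDual.toWeakDual (NormedSpace.inclusionInDoubleDual ℂ E e)
  have hK := WeakDual.isCompact_closedBall (𝕜 := ℂ) (0 : StrongDual ℂ (StrongDual ℂ E)) C
  have hmem : ↑(U.map ι) ≤ 𝓟 (WeakDual.toStrongDual ⁻¹'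
      Metric.closedBall (0 : StrongDual ℂ (StrongDual ℂ E)) C) := by
    rw [le_principal_iff]
    change ι ⁻¹' _ ∈ (U : Filter E)
    filter_upwards [hU hC] with e he
    have := (NormedSpace.double_dual_bound ℂ E e).trans he
    exact (mem_closedBall_zero_iff
      (a := NormedSpace.inclusionInDoubleDual ℂ E e)).2 this
  obtain ⟨p, -, hp⟩ := hK.ultrafilter_le_nhds _ hmem
  refine ⟨U, WeakDual.toStrongDual p, hU, fun Φ => ?_⟩
  exact ((WeakDual.eval_continuous Φ).tendsto p).comp hp

/-- Hahn–Banach separation for the weak* topology. -/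
theorem toWeakDual_mem_closure_of_convex {E : Type*} [NormedAddCommGroup E] [NormedSpace ℂ E]
    {K : Set (StrongDual ℂ E)} (hK : Convex ℝ K) (p : StrongDual ℂ E)
    (h : ∀ (m : E) (s : ℝ), (∀ q ∈ K, (q m).re ≤ s) → (p m).re ≤ s) :
    StrongDual.toWeakDual p ∈ closure (StrongDual.toWeakDual '' K) := by
  by_contra hcon
  let W := WeakBilin (topDualPairing ℂ E)
  have : ContinuousSMul ℝ W := IsScalarTower.continuousSMul ℂ
  let K' : Set W := StrongDual.toWeakDual '' K
  have hconv : Convex ℝ K' := by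
    rintro _ ⟨a, ha, rfl⟩ _ ⟨b, hb, rfl⟩ s t hs ht hst
    exact ⟨s • a + t • b, hK ha hb hs ht hst, rfl⟩
  obtain ⟨f, s, h1, h2⟩ := RCLike.geometric_hahn_banach_closed_point (𝕜 := ℂ) (E := W)
    hconv.closure isClosed_closure hcon
  -- Weak*-continuous functionals are evaluations at points of `E`.
  obtain ⟨m, rfl⟩ := LinearMap.dualEmbedding_surjective (topDualPairing ℂ E) f
  exact (h m s fun q hq => (h1 _ (subset_closure ⟨q, hq, rfl⟩)).le).not_gt h2

end Topology

/-! ### Weak* density of the normal states in the state space. -/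

section Density

variable {H : Type*} [NormedAddCommGroup H] [InnerProductSpace ℂ H] [CompleteSpace H]
  {M : VonNeumannAlgebra H}
  {A : Type*} [NonUnitalNormedRing A] [NormedSpace ℂ A] (j : A ≃ₗᵢ[ℂ] Predual M)

theorem vectorElement_mem_normalStates {ξ : H} (hξ : ‖ξ‖ = 1) :
    vectorElement j ξ ξ ∈ normalStates j := by
  refine ⟨fun m hm => ?_, ?_⟩
  · rw [apply_vectorElement]
    exact (ContinuousLinearMap.nonneg_iff_isPositive _).1 hm |>.inner_nonneg_right ξ
  · rw [apply_vectorElement]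
    simp [inner_self_eq_norm_sq_to_K, hξ]

theorem convex_normalStates :
    Convex ℝ ((fun a => (j a : StrongDual ℂ M.toStarSubalgebra)) '' normalStates j) := by
  rintro _ ⟨a, ha, rfl⟩ _ ⟨b, hb, rfl⟩ s t hs ht hst
  have key : ∀ m, (j ((s : ℂ) • a + (t : ℂ) • b) : StrongDual ℂ M.toStarSubalgebra) m
      = s * (j a : StrongDual ℂ M.toStarSubalgebra) m
        + t * (j b : StrongDual ℂ M.toStarSubalgebra) m := fun m => by
    rw [map_add, map_smul, map_smul]; rfl
  refine ⟨(s : ℂ) • a + (t : ℂ) • b, ⟨fun m hm => ?_, ?_⟩, ContinuousLinearMap.ext key⟩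
  · rw [key]
    exact add_nonneg (mul_nonneg (by exact_mod_cast hs) (ha.1 m hm))
      (mul_nonneg (by exact_mod_cast ht) (hb.1 m hm))
  · rw [key, ha.2, hb.2, mul_one, mul_one]
    exact_mod_cast hst

-- By separation it suffices to bound `Re p(m)` by any `s` that bounds `Re q(m)` for all normal
-- states `q`. Unit vector states already force `Re m ≤ s` as operators, and `p` preserves this
-- inequality.
open ComplexStarModule in
theorem IsState.mem_closure_normalStates {p : StrongDual ℂ M.toStarSubalgebra}
    (hp : IsState M p) :
    StrongDual.toWeakDual p ∈ closure
      (StrongDual.toWeakDual '' ((fun a => (j a : StrongDual ℂ M.toStarSubalgebra)) ''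
        normalStates j)) := by
  refine toWeakDual_mem_closure_of_convex (convex_normalStates j) p fun m s hs => ?_
  have hsa : IsSelfAdjoint ((realPart m : M.toStarSubalgebra) : H →L[ℂ] H) :=
    congrArg Subtype.val (realPart m).2
  have hunit : ∀ ξ : H, ‖ξ‖ = 1 →
      (inner ℂ ξ (((realPart m : M.toStarSubalgebra) : H →L[ℂ] H) ξ)).re ≤ s := fun ξ hξ => by
    have hv := vectorElement_mem_normalStates j hξ
    rw [← apply_vectorElement j, ← IsState.re_apply hv m]
    exact hs _ ⟨_, hv, rfl⟩
  have hle : ((realPart m : M.toStarSubalgebra) : H →L[ℂ] H) ≤ algebraMap ℝ _ s := by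
    rw [ContinuousLinearMap.le_def]
    refine (ContinuousLinearMap.isPositive_def' (𝕜 := ℂ)).2
      ⟨(IsSelfAdjoint.algebraMap _ (.all s)).sub hsa, fun ξ => ?_⟩
    have h1 : (inner ℂ ξ (((realPart m : M.toStarSubalgebra) : H →L[ℂ] H) ξ)).re
        ≤ s * ‖ξ‖ ^ 2 := by
      rcases eq_or_ne ξ 0 with rfl | hξ
      · simp
      have hξ0 : 0 < ‖ξ‖ := norm_pos_iff.2 hξ
      have h2 := hunit (((‖ξ‖⁻¹ : ℝ) : ℂ) • ξ) (by
        rw [norm_smul, Complex.norm_real, norm_inv, norm_norm, inv_mul_cancel₀ hξ0.ne'])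
      rw [map_smul, inner_smul_left, inner_smul_right, Complex.conj_ofReal, Complex.re_ofReal_mul,
        Complex.re_ofReal_mul] at h2
      field_simp at h2
      linarith
    rw [ContinuousLinearMap.reApplyInnerSelf_apply, inner_re_symm]
    have h3 : (inner ℂ ξ ((algebraMap ℝ (H →L[ℂ] H) s) ξ)).re = s * ‖ξ‖ ^ 2 := by
      rw [Algebra.algebraMap_eq_smul_one]
      change (inner ℂ ξ ((s : ℂ) • ξ)).re = _
      rw [inner_smul_right, Complex.re_ofReal_mul, inner_self_eq_norm_sq_to_K]
      norm_cast
    rw [sub_apply, inner_sub_right, map_sub]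
    change 0 ≤ (inner ℂ ξ _).re - (inner ℂ ξ _).re
    linarith
  have h6 := hp.apply_le hle
  rw [Complex.le_def] at h6
  rw [hp.re_apply m]
  simpa using h6.1

end Density

/-! ### Coefficient functionals and the operators `T_p`. -/

section Coefficient

variable {A : Type*} [NonUnitalNormedRing A] [NormedSpace ℂ A]
  {X : Type*} [NormedAddCommGroup X] [NormedSpace ℂ X]

/-- The functional `a ↦ ⟨T_a m, w⟩` on `A`. -/
noncomputable def coefficient (π : LeftBanachModule A X) (m : Bidual X) (w : StrongDual ℂ X) :
    StrongDual ℂ A :=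
  LinearMap.mkContinuous
    { toFun := fun a => m (w ∘L π.act a)
      map_add' := fun a b => by rw [← map_add, map_add, ContinuousLinearMap.comp_add]
      map_smul' := fun c a => by
        rw [RingHom.id_apply, ← map_smul, map_smul, ContinuousLinearMap.comp_smul] }
    (‖m‖ * ‖w‖) (fun a => by
      have h : ‖π.act a‖ ≤ ‖a‖ :=
        ContinuousLinearMap.opNorm_le_bound _ (norm_nonneg a) (π.norm_act_le a)
      calc ‖m (w ∘L π.act a)‖ ≤ ‖m‖ * ‖w ∘L π.act a‖ := m.le_opNorm _
        _ ≤ ‖m‖ * (‖w‖ * ‖π.act a‖) := by gcongr; exact w.opNorm_comp_le _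
        _ ≤ ‖m‖ * (‖w‖ * ‖a‖) := by gcongr
        _ = ‖m‖ * ‖w‖ * ‖a‖ := by ring)

@[simp]
theorem coefficient_apply (π : LeftBanachModule A X) (m : Bidual X) (w : StrongDual ℂ X) (a : A) :
    coefficient π m w a = m (w ∘L π.act a) := rfl

theorem norm_coefficient_le (π : LeftBanachModule A X) (m : Bidual X) (w : StrongDual ℂ X) :
    ‖coefficient π m w‖ ≤ ‖m‖ * ‖w‖ :=
  LinearMap.mkContinuous_norm_le _ (by positivity) _

/-- The operator `T_p` on `X^{**}` for `p ∈ A^{**}`: the weak*-continuous extension of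
`a ↦ T_a`. -/
noncomputable def bidualAct (π : LeftBanachModule A X) (p : Bidual A) :
    Bidual X →L[ℂ] Bidual X :=
  LinearMap.mkContinuous₂
    (LinearMap.mk₂ ℂ (fun m w => p (coefficient π m w))
      (fun m m' w => by rw [← map_add]; rfl)
      (fun c m w => by rw [← map_smul]; rfl)
      (fun m w w' => by
        rw [← map_add]; congr 1; ext a; simp [ContinuousLinearMap.add_comp])
      (fun c m w => by
        rw [← map_smul]; congr 1; ext a; simp [ContinuousLinearMap.smul_comp])) ‖p‖
    (fun m w => by
      refine (p.le_opNorm _).trans ?_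
      rw [mul_assoc]
      gcongr
      exact norm_coefficient_le π m w)

/-- `T_a → T_p` weak* when `a → p` in `σ(A^{**}, A^*)`. -/
theorem tendsto_bidualMap_act (π : LeftBanachModule A X) {F : Filter A} {p : Bidual A}
    (h : ∀ Φ : StrongDual ℂ A, Tendsto (fun a => Φ a) F (𝓝 (p Φ))) :
    Tendsto (fun a => bidualMap (π.act a)) F (@nhds _ (weakStarTopology X) (bidualAct π p)) := by
  simp only [nhds_iInf, nhds_induced, tendsto_iInf, tendsto_comap_iff]
  intro m w hmw
  -- A whole tensor series collapses to a single functional on `A`, so convergence in `σ(A**, A*)`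
  -- is enough.
  have hs : Summable fun n => coefficient π (m n) (w n) :=
    .of_norm_bounded hmw fun n => norm_coefficient_le π (m n) (w n)
  have h1 := h (∑' n, coefficient π (m n) (w n))
  rw [p.map_tsum hs] at h1
  refine h1.congr fun a => ?_
  exact (ContinuousLinearMap.apply ℂ ℂ a).map_tsum hs

theorem continuous_weakStar_apply (m : Bidual X) (w : StrongDual ℂ X) :
    Continuous[weakStarTopology X, inferInstance] fun T : Bidual X →L[ℂ] Bidual X => T m w := by
  -- The elementary tensor `m ⊗ w` is the series whose only nonzero term has index `0`.
  have h : (fun T : Bidual X →L[ℂ] Bidual X => T m w) = fun T : Bidual X →L[ℂ] Bidual X =>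
      ∑' n, T ((fun n : ℕ => if n = 0 then m else 0) n) ((fun _ => w) n) := by
    funext T
    rw [tsum_eq_single 0 fun n hn => by simp [hn]]
    simp
  rw [h]
  refine continuous_iInf_dom (i := fun n : ℕ => if n = 0 then m else 0)
    (continuous_iInf_dom (i := fun _ => w) (continuous_iInf_dom (i := ?_) continuous_induced_dom))
  exact summable_of_ne_finset_zero (s := {0}) fun n hn => by
    dsimp only
    rw [if_neg (by simpa using hn)]
    exact mul_eq_zero_of_left (norm_zero (E := Bidual X)) _

end Coefficient

/-! ### Invariant states versus fixed points. -/

section FixedPoint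

variable {H : Type*} [NormedAddCommGroup H] [InnerProductSpace ℂ H] [CompleteSpace H]
  {M : VonNeumannAlgebra H}
  {A : Type*} [NonUnitalNormedRing A] [NormedSpace ℂ A] (j : A ≃ₗᵢ[ℂ] Predual M)
  {X : Type*} [NormedAddCommGroup X] [NormedSpace ℂ X]
  {G : Type*} [Group G] (α : G →* (M.toStarSubalgebra ≃⋆ₐ[ℂ] M.toStarSubalgebra))

/-- If all the preadjoints are bijective then they are genuine preadjoints: the default value `0`
is bijective only on the zero space, where it satisfies the duality relation too. -/
theorem apply_predualAction (hβ : ∀ x : G, Function.Bijective (predualAction j α x)) (x : G)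
    (a : A) (m : M.toStarSubalgebra) :
    (j (predualAction j α x a) : StrongDual ℂ M.toStarSubalgebra) m
      = (j a : StrongDual ℂ M.toStarSubalgebra) (α x⁻¹ m) := by
  by_cases h : ∃ B : A →L[ℂ] A, ∀ a m,
      (j (B a) : StrongDual ℂ M.toStarSubalgebra) m
        = (j a : StrongDual ℂ M.toStarSubalgebra) (α x⁻¹ m)
  · rw [predualAction, preadjoint, dif_pos h]
    exact h.choose_spec a m
  · have h0 : predualAction j α x = 0 := by rw [predualAction, preadjoint, dif_neg h]
    have : a = 0 := (hβ x).1 (by simp [h0])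
    subst this
    rw [map_zero, j.map_zero]
    rfl

theorem predualAction_predualAction_inv (hβ : ∀ x : G, Function.Bijective (predualAction j α x))
    (x : G) (a : A) : predualAction j α x (predualAction j α x⁻¹ a) = a :=
  predual_ext j fun m => by
    rw [apply_predualAction j α hβ, apply_predualAction j α hβ, ← StarAlgEquiv.mul_apply,
      ← map_mul, inv_inv, mul_inv_cancel, map_one]
    rfl

theorem IsState.norm_le_of_mem_normalStates {a : A} (ha : a ∈ normalStates j) : ‖a‖ ≤ 2 :=
  (j.norm_map a).symm.trans_le (IsState.norm_le ha)

/-- A state of `M`, as an element of `A^{**}`, is a weak* limit of normal states. -/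
theorem IsState.exists_bidual {p : StrongDual ℂ M.toStarSubalgebra} (hp : IsState M p) :
    ∃ (F : Filter A) (q : Bidual A), F.NeBot ∧ normalStates j ∈ F ∧
      (∀ Φ : StrongDual ℂ A, Tendsto (fun a => Φ a) F (𝓝 (q Φ))) ∧
      ∀ (Φ : StrongDual ℂ A) (m : M.toStarSubalgebra),
        (∀ a, Φ a = (j a : StrongDual ℂ M.toStarSubalgebra) m) → q Φ = p m := by
  have h := hp.mem_closure_normalStates j
  rw [Set.image_image] at h
  obtain ⟨F, hF, hmem, hlim⟩ := exists_filter_of_mem_closure_image h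
  -- Refining to an ultrafilter gives a limit on all of `A*`; it agrees with `p` on any functional
  -- represented by an element of `M`.
  obtain ⟨U, q, hU, hq⟩ := exists_ultrafilter_tendsto_bidual F (C := 2)
    (by filter_upwards [hmem] with a ha using IsState.norm_le_of_mem_normalStates j ha)
  refine ⟨U, q, inferInstance, hU hmem, hq, fun Φ m hΦ => ?_⟩
  refine tendsto_nhds_unique (hq Φ) ?_
  have h1 := ((WeakDual.eval_continuous m).tendsto _).comp (hlim.mono_left hU)
  exact h1.congr fun a => (hΦ a).symm

variable {j α}

/-- The fixed point is `T_q`, with `q ∈ A**` the invariant state. By `hρ`, conjugation by `x`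
changes a coefficient represented by `n` into one represented by `α_{x⁻¹} n`, where `p` has the same
value. -/
theorem hasFixedPoint_of_isGAmenable
    (hβ : ∀ x : G, Function.Bijective (predualAction j α x))
    (π : LeftBanachModule A X) (ρ : G → X →L[ℂ] X)
    (hρ : ∀ x a ξ, ρ x (π.act a (ρ x⁻¹ ξ)) = π.act (predualAction j α x a) ξ)
    (hM : IsGAmenable M α) : HasFixedPoint j π ρ := by
  obtain ⟨p, hp, hinv⟩ := hM
  obtain ⟨F, q, hF, hmem, hlim, hq⟩ := hp.exists_bidual j
  refine ⟨bidualAct π q, ?_, fun x => ?_⟩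
  · exact @mem_closure_of_tendsto _ (weakStarTopology X) _ _ _ _ _ _
      (tendsto_bidualMap_act π hlim) (by
        filter_upwards [hmem] with a ha using Set.mem_image_of_mem _ ha)
  · ext m w
    obtain ⟨n, hn⟩ := exists_forall_predual_apply_eq j (coefficient π m w)
    change q (coefficient π (bidualMap (ρ x⁻¹) m) (w ∘L ρ x)) = q (coefficient π m w)
    rw [hq _ n hn, ← hinv x n]
    refine hq _ _ fun a => ?_
    rw [← apply_predualAction j α hβ, ← hn]
    change m _ = m _
    congr 1
    ext ξ
    exact congrArg w (hρ x a ξ)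

/-- Every operator in `P_X` is `T_q` for a weak* limit `q` of normal states. Since each element of
`M` is a coefficient by `hcoef`, invariance of `T_q` is invariance of `q` on `M`. -/
theorem isGAmenable_of_hasFixedPoint
    (hβ : ∀ x : G, Function.Bijective (predualAction j α x))
    (π : LeftBanachModule A X) (ρ : G → X →L[ℂ] X)
    (hρ : ∀ x a ξ, ρ x (π.act a (ρ x⁻¹ ξ)) = π.act (predualAction j α x a) ξ)
    (hcoef : ∀ Φ : StrongDual ℂ A, ∃ m w, coefficient π m w = Φ)
    (h : HasFixedPoint j π ρ) : IsGAmenable M α := by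
  obtain ⟨T, hT, hfix⟩ := h
  obtain ⟨F, hF, hmem, hlim⟩ :=
    @exists_filter_of_mem_closure_image _ _ (weakStarTopology X) _ _ _ hT
  obtain ⟨U, q, hU, hq⟩ := exists_ultrafilter_tendsto_bidual F (C := 2)
    (by filter_upwards [hmem] with a ha using IsState.norm_le_of_mem_normalStates j ha)
  have hTq : ∀ m w, T m w = q (coefficient π m w) := fun m w => by
    refine tendsto_nhds_unique ?_ (hq (coefficient π m w))
    exact (@Continuous.tendsto _ _ (weakStarTopology X) _ _
      (continuous_weakStar_apply m w) T).comp (hlim.mono_left hU)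
  let J : A →L[ℂ] StrongDual ℂ M.toStarSubalgebra :=
    (Predual M).subtypeL ∘L j.toContinuousLinearEquiv.toContinuousLinearMap
  let p : StrongDual ℂ M.toStarSubalgebra := q ∘L J.flip
  have hp : ∀ m, Tendsto (fun a => (j a : StrongDual ℂ M.toStarSubalgebra) m) U (𝓝 (p m)) :=
    fun m => hq (J.flip m)
  refine ⟨p, ⟨fun m hm => ?_, ?_⟩, fun x m => ?_⟩
  · refine ge_of_tendsto (hp m) ?_
    filter_upwards [hU hmem] with a ha using ha.1 m hm
  · refine tendsto_nhds_unique (hp 1) (tendsto_const_nhds.congr' ?_)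
    filter_upwards [hU hmem] with a ha using ha.2.symm
  · obtain ⟨m', w, hmw⟩ := hcoef (J.flip m)
    have h1 := congrArg (fun S : Bidual X →L[ℂ] Bidual X => S m' w) (hfix x)
    change T (bidualMap (ρ x⁻¹) m') (w ∘L ρ x) = T m' w at h1
    rw [hTq, hTq, hmw] at h1
    refine Eq.trans (congrArg q ?_) h1
    ext a
    calc _ = J.flip m (predualAction j α x a) := (apply_predualAction j α hβ x a m).symm
      _ = coefficient π m' w (predualAction j α x a) := by rw [hmw]
      _ = _ := by
        change m' _ = m' _
        congr 1
        ext ξ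
        exact congrArg w (hρ x a ξ).symm

/-- If `A` is a retract of `X`, compatibly with the actions, then every functional on `A` is
a coefficient of `X`. -/
theorem exists_coefficient_eq {l : Filter A} (hl : IsBoundedApproxIdentity l)
    (π : LeftBanachModule A X) (q : X →L[ℂ] A) (s : A →L[ℂ] X)
    (hqs : ∀ a b, q (π.act a (s b)) = a * b) (Φ : StrongDual ℂ A) :
    ∃ m w, coefficient π m w = Φ := by
  have := hl.1.neBot
  obtain ⟨C, hC⟩ := hl.2
  obtain ⟨U, E, hU, hE⟩ := exists_ultrafilter_tendsto_bidual l hC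
  -- The pair is `s** E` and `Φ ∘ q`, where `E` is a limit of the approximate identity; its
  -- coefficient at `a` is `lim Φ(a e)`.
  refine ⟨E ∘L (ContinuousLinearMap.precomp ℂ s), Φ ∘L q, ?_⟩
  ext a
  have h1 := hE ((Φ ∘L q) ∘L π.act a ∘L s)
  have h2 := (Φ.continuous.tendsto a).comp ((hl.1.tendsto_mul_left a).mono_left hU)
  refine tendsto_nhds_unique h1 (h2.congr fun e => ?_)
  exact congrArg Φ (hqs a e).symm

end FixedPoint

/-! ### Cohen factorization. -/

section Factorization

variable {A : Type*} [NonUnitalNormedRing A] [NormedSpace ℂ A]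
  [IsScalarTower ℂ A A] [SMulCommClass ℂ A A] [CompleteSpace A]

/-- The element `a + r` of the unitization, as an operator on `A`. -/
noncomputable def mulAddScalar (a : A) (r : ℝ) : A →L[ℂ] A :=
  ContinuousLinearMap.mul ℂ A a + (r : ℂ) • 1

/-- The inductive step in Cohen's factorization theorem. -/
theorem exists_isUnit_mulAddScalar {l : Filter A} (hl : IsBoundedApproxIdentity l) {C t : ℝ}
    (hC : ∀ᶠ e in l, ‖e‖ ≤ C) (ht : 0 < t) (htC : t * (C + 1) ≤ 1 / 2)
    (x a : A) (r : ℝ) (hu : IsUnit (mulAddScalar a r)) {ε : ℝ} (hε : 0 < ε) :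
    ∃ e : A, ‖e‖ ≤ C ∧ IsUnit (mulAddScalar (a + (r * t : ℝ) • e) (r * (1 - t))) ∧
      ‖Ring.inverse (mulAddScalar (a + (r * t : ℝ) • e) (r * (1 - t))) x
        - Ring.inverse (mulAddScalar a r) x‖ < ε := by
  have := hl.1.neBot
  -- `z e = 1 - t(1 - e)` lies within `t(C + 1) ≤ 1/2` of the identity, so its inverse `w e` has
  -- norm at most 2.
  let z : A → A →L[ℂ] A := fun e => mulAddScalar (t • e) (1 - t)
  let w : A → A →L[ℂ] A := fun e => Ring.inverse (z e)
  have hz : ∀ᶠ e in l, ‖1 - z e‖ ≤ 1 / 2 := by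
    filter_upwards [hC] with e he
    have h1 : 1 - z e = (t : ℂ) • (1 - ContinuousLinearMap.mul ℂ A e) := by
      ext b
      simp [z, mulAddScalar, sub_smul, smul_sub]
      abel
    rw [h1, norm_smul, Complex.norm_real, Real.norm_of_nonneg ht.le]
    refine le_trans ?_ htC
    gcongr
    calc ‖(1 : A →L[ℂ] A) - ContinuousLinearMap.mul ℂ A e‖
        ≤ ‖(1 : A →L[ℂ] A)‖ + ‖ContinuousLinearMap.mul ℂ A e‖ := norm_sub_le _ _
      _ ≤ 1 + C := by
        gcongr
        · exact ContinuousLinearMap.norm_id_le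
        · exact (ContinuousLinearMap.opNorm_mul_apply_le ℂ A e).trans he
      _ = C + 1 := add_comm _ _
  have hzu : ∀ᶠ e in l, IsUnit (z e) := by
    filter_upwards [hz] with e he
    have := isUnit_one_sub_of_norm_lt_one (x := 1 - z e) (lt_of_le_of_lt he (by norm_num))
    simpa using this
  have hw : ∀ᶠ e in l, ‖w e‖ ≤ 2 := by
    filter_upwards [hz, hzu] with e he heu
    have h1 : w e = 1 + (1 - z e) * w e := by
      rw [sub_mul, one_mul, Ring.mul_inverse_cancel _ heu]; abel
    have h2 : ‖w e‖ ≤ 1 + 1 / 2 * ‖w e‖ := by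
      calc ‖w e‖ = ‖1 + (1 - z e) * w e‖ := by rw [← h1]
        _ ≤ ‖(1 : A →L[ℂ] A)‖ + ‖(1 - z e) * w e‖ := norm_add_le _ _
        _ ≤ 1 + ‖1 - z e‖ * ‖w e‖ := by
          gcongr
          · exact ContinuousLinearMap.norm_id_le
          · exact norm_mul_le _ _
        _ ≤ 1 + 1 / 2 * ‖w e‖ := by gcongr
    linarith
  have hlim : ∀ b : A, Tendsto (fun e => b - e * b) l (𝓝 0) := fun b => by
    simpa using (tendsto_const_nhds (x := b)).sub (hl.1.tendsto_mul_right b)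
  have hwx : Tendsto (fun e => w e x) l (𝓝 x) := by
    rw [tendsto_iff_norm_sub_tendsto_zero]
    have h0 := ((hlim x).norm.const_mul (2 * t))
    rw [norm_zero, mul_zero] at h0
    refine squeeze_zero' (Eventually.of_forall fun _ => norm_nonneg _) ?_ h0
    filter_upwards [hw, hzu] with e h1 h2
    have h3 : w e x - x = w e ((t : ℂ) • (x - e * x)) := by
      have h4 : x = w e (z e x) := by
        exact (congrArg (fun S : A →L[ℂ] A => S x) (Ring.inverse_mul_cancel _ h2)).symm
      have h5 : (t : ℂ) • (x - e * x) = x - z e x := by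
        simp [z, mulAddScalar, sub_smul, smul_sub]
        abel
      rw [h5, map_sub, ← h4]
    rw [h3]
    refine ((w e).le_opNorm _).trans ?_
    rw [norm_smul, Complex.norm_real, Real.norm_of_nonneg ht.le, ← mul_assoc]
    gcongr
  have hwL : Tendsto (fun e => w e * ContinuousLinearMap.mul ℂ A a) l
      (𝓝 (ContinuousLinearMap.mul ℂ A a)) := by
    rw [tendsto_iff_norm_sub_tendsto_zero]
    have h0 := ((hlim a).norm.const_mul (2 * t))
    rw [norm_zero, mul_zero] at h0
    refine squeeze_zero' (Eventually.of_forall fun _ => norm_nonneg _) ?_ h0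
    filter_upwards [hw, hzu] with e h1 h2
    have h3 : w e * ContinuousLinearMap.mul ℂ A a - ContinuousLinearMap.mul ℂ A a
        = w e * ((t : ℂ) • ContinuousLinearMap.mul ℂ A (a - e * a)) := by
      have h4 : ContinuousLinearMap.mul ℂ A a = w e * (z e * ContinuousLinearMap.mul ℂ A a) := by
        rw [← mul_assoc, Ring.inverse_mul_cancel _ h2, one_mul]
      have h5 : (t : ℂ) • ContinuousLinearMap.mul ℂ A (a - e * a)
          = ContinuousLinearMap.mul ℂ A a - z e * ContinuousLinearMap.mul ℂ A a := by
        ext b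
        simp [z, mulAddScalar, sub_smul, smul_sub, mul_assoc]
        abel
      rw [h5, mul_sub, ← h4]
    rw [h3]
    refine (norm_mul_le _ _).trans ?_
    rw [norm_smul, Complex.norm_real, Real.norm_of_nonneg ht.le, ← mul_assoc]
    gcongr
    exact ContinuousLinearMap.opNorm_mul_apply_le ℂ A _
  let b : A → A →L[ℂ] A := fun e => mulAddScalar (a + (r * t : ℝ) • e) (r * (1 - t))
  -- The new element factors as `z (w a + r)`. As `w a → a` in norm, the second factor tends to the
  -- invertible `a + r`. The inverse `(w a + r)⁻¹ w` sends `x` near `(a + r)⁻¹ x`, because `w x →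
  -- x`, even though `w` need not tend to `1` in norm.
  have hb : ∀ᶠ e in l, b e = z e * (w e * ContinuousLinearMap.mul ℂ A a + (r : ℂ) • 1) := by
    filter_upwards [hzu] with e he
    rw [mul_add, ← mul_assoc, Ring.mul_inverse_cancel _ he, one_mul]
    ext c
    simp [b, z, mulAddScalar, sub_smul, smul_sub, mul_smul, mul_sub]
    abel
  have hlimb : Tendsto (fun e => w e * ContinuousLinearMap.mul ℂ A a + (r : ℂ) • 1) l
      (𝓝 (mulAddScalar a r)) := hwL.add_const _
  obtain ⟨u, hu⟩ := hu
  have hev : ∀ᶠ e in l, IsUnit (w e * ContinuousLinearMap.mul ℂ A a + (r : ℂ) • 1) :=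
    hlimb (by rw [← hu]; exact Units.nhds u)
  have hinv : Tendsto (fun e => Ring.inverse (w e * ContinuousLinearMap.mul ℂ A a + (r : ℂ) • 1)
      (w e x)) l (𝓝 (Ring.inverse (mulAddScalar a r) x)) := by
    have h1 : Tendsto (fun e => Ring.inverse (w e * ContinuousLinearMap.mul ℂ A a + (r : ℂ) • 1)) l
        (𝓝 (Ring.inverse (mulAddScalar a r))) := by
      rw [← hu] at hlimb ⊢
      exact (NormedRing.inverse_continuousAt u).tendsto.comp hlimb
    exact ((isBoundedBilinearMap_apply (𝕜 := ℂ) (E := A) (F := A)).continuous.tendsto _).comp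
      (h1.prodMk_nhds hwx)
  have hfin := (tendsto_iff_norm_sub_tendsto_zero.1 hinv).eventually (gt_mem_nhds hε)
  obtain ⟨e, h1, h2, h3, h4, h5⟩ := (hC.and (hzu.and (hb.and (hev.and hfin)))).exists
  refine ⟨e, h1, ?_, ?_⟩
  · change IsUnit (b e)
    rw [h3]; exact h2.mul h4
  · change ‖Ring.inverse (b e) x - _‖ < ε
    obtain ⟨p, hp⟩ := h2
    obtain ⟨q, hq⟩ := h4
    have h6 : Ring.inverse (b e)
        = Ring.inverse (w e * ContinuousLinearMap.mul ℂ A a + (r : ℂ) • 1) * w e := by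
      change _ = _ * Ring.inverse (z e)
      rw [h3, ← hp, ← hq, Ring.inverse_unit p, Ring.inverse_unit q, ← Units.val_mul,
        ← Units.val_mul, Ring.inverse_unit, mul_inv_rev]
    rw [h6]
    exact h5

/-- **Cohen's factorization theorem** for a Banach algebra with a bounded approximate identity. -/
theorem exists_mul_eq_of_isBoundedApproxIdentity {l : Filter A} (hl : IsBoundedApproxIdentity l)
    (x : A) : ∃ a y : A, a * y = x := by
  have := hl.1.neBot
  obtain ⟨C, hC⟩ := hl.2
  have hC0 : 0 ≤ C := by
    obtain ⟨e, he⟩ := hC.exists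
    exact (norm_nonneg e).trans he
  obtain ⟨t, ht, htC⟩ : ∃ t : ℝ, 0 < t ∧ t * (C + 1) = 1 / 2 :=
    ⟨1 / (2 * (C + 1)), by positivity, by field_simp⟩
  have ht1 : t < 1 := by nlinarith
  let P := {s : A × ℝ // IsUnit (mulAddScalar s.1 s.2)}
  have step : ∀ (n : ℕ) (s : P), ∃ s' : P, ‖s'.1.1 - s.1.1‖ ≤ |s.1.2| * t * C ∧
      s'.1.2 = s.1.2 * (1 - t) ∧
      ‖Ring.inverse (mulAddScalar s'.1.1 s'.1.2) x - Ring.inverse (mulAddScalar s.1.1 s.1.2) x‖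
        ≤ (1 / 2) ^ n := by
    rintro n ⟨⟨a, r⟩, hu⟩
    obtain ⟨e, h1, h2, h3⟩ := exists_isUnit_mulAddScalar hl hC ht htC.le x a r hu
      (ε := (1 / 2) ^ n) (by positivity)
    refine ⟨⟨(_, _), h2⟩, ?_, rfl, h3.le⟩
    simp only [add_sub_cancel_left, norm_smul, norm_mul, Real.norm_eq_abs, abs_of_pos ht]
    gcongr
  choose f hf1 hf2 hf3 using step
  -- Starting from the identity, the scalar part is `(1 - t)^n`. The algebra parts `a_n` and the
  -- vectors `y_n = (a_n + (1 - t)^n)⁻¹ x` are Cauchy, so `x = a_n y_n + (1 - t)^n y_n` tends to `a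
  -- y`.
  let s : ℕ → P := fun n => Nat.rec ⟨(0, 1), by simp [mulAddScalar]⟩ f n
  have hs : ∀ n, s (n + 1) = f n (s n) := fun n => rfl
  have hr : ∀ n, (s n).1.2 = (1 - t) ^ n := by
    intro n
    induction n with
    | zero => rfl
    | succ n ih => rw [hs, hf2, ih, pow_succ]
  have h1t : 0 ≤ 1 - t := by linarith
  have hca : CauchySeq fun n => (s n).1.1 := by
    refine cauchySeq_of_le_geometric (1 - t) (t * C) (by linarith) fun n => ?_
    rw [dist_comm, dist_eq_norm, hs]
    refine (hf1 n (s n)).trans ?_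
    rw [hr, abs_of_nonneg (by positivity)]
    linarith
  have hcy : CauchySeq fun n => Ring.inverse (mulAddScalar (s n).1.1 (s n).1.2) x := by
    refine cauchySeq_of_le_geometric (1 / 2) 1 (by norm_num) fun n => ?_
    rw [dist_comm, dist_eq_norm, hs, one_mul]
    exact hf3 n (s n)
  obtain ⟨a, ha⟩ := cauchySeq_tendsto_of_complete hca
  obtain ⟨y, hy⟩ := cauchySeq_tendsto_of_complete hcy
  refine ⟨a, y, ?_⟩
  have hr0 : Tendsto (fun n => (((s n).1.2 : ℝ) : ℂ)) atTop (𝓝 0) := by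
    simp only [hr]
    exact_mod_cast (Complex.continuous_ofReal.tendsto _).comp
      (tendsto_pow_atTop_nhds_zero_of_lt_one h1t (by linarith))
  have h1 := (ha.mul hy).add (hr0.smul hy)
  simp only [zero_smul, add_zero] at h1
  refine tendsto_nhds_unique h1 (tendsto_const_nhds.congr fun n => ?_)
  have h2 := congrArg (fun S : A →L[ℂ] A => S x) (Ring.mul_inverse_cancel _ (s n).2)
  exact h2.symm

end Factorization

/-! ### Essential modules and `A` over itself. -/

section Modules

variable {A : Type*} [NonUnitalNormedRing A] [NormedSpace ℂ A]
  [IsScalarTower ℂ A A] [SMulCommClass ℂ A A]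
  {X : Type*} [NormedAddCommGroup X] [NormedSpace ℂ X] {l : Filter A}
  {G : Type*} [Group G] [TopologicalSpace G] {β : G → A →L[ℂ] A} {γ : G →* 𝓜(ℂ, A)}

theorem multiplierAct_act (hl : IsBoundedApproxIdentity l) {π : LeftBanachModule A X}
    (hπ : π.IsEssential) (c : 𝓜(ℂ, A)) (a : A) (η : X) :
    multiplierAct hl hπ c (π.act a η) = π.act (c.fst a) η :=
  have := hl.1.neBot
  tendsto_nhds_unique (tendsto_limUnder_multiplier hl hπ c (π.act a η))
    (tendsto_multiplier hl π c a η)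

/-- Centrality moves `γ(x⁻¹)` from `b` onto the right of `a`; then `γ(x)` acts on the left factor
alone. -/
theorem IsInnerVia.apply_mul (hγ : IsInnerVia β γ) (hl : IsBoundedApproxIdentity l)
    (x : G) (a b : A) : (γ x).fst (a * (γ x⁻¹).fst b) = β x a * b := by
  rw [← (γ x⁻¹).central, fst_mul hl, hγ.eq_conj]

/-- Writing `ξ = b η` reduces the covariance relation to the one in `A`. -/
theorem IsInnerVia.multiplierAct_conj (hγ : IsInnerVia β γ) (hl : IsBoundedApproxIdentity l)
    {π : LeftBanachModule A X} (hπ : π.IsEssential) (x : G) (a : A) (ξ : X) :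
    multiplierAct hl hπ (γ x) (π.act a (multiplierAct hl hπ (γ x⁻¹) ξ))
      = π.act (β x a) ξ := by
  obtain ⟨b, η, rfl⟩ := hπ ξ
  rw [multiplierAct_act hl hπ (γ x⁻¹), ← π.act_mul, multiplierAct_act, hγ.apply_mul hl, π.act_mul]

/-- `A` as a left module over itself, lifted to a larger universe. -/
noncomputable def uliftSelfModule.{u₁} (A : Type*) [NonUnitalNormedRing A] [NormedSpace ℂ A]
    [IsScalarTower ℂ A A] [SMulCommClass ℂ A A] : LeftBanachModule A (ULift.{u₁} A) where
  act := ContinuousLinearMap.compL ℂ (ULift.{u₁} A) A (ULift.{u₁} A)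
      (ContinuousLinearEquiv.ulift (R₁ := ℂ) (M₁ := A)).symm.toContinuousLinearMap ∘L
    (ContinuousLinearMap.compL ℂ (ULift.{u₁} A) A A).flip
      (ContinuousLinearEquiv.ulift (R₁ := ℂ) (M₁ := A)).toContinuousLinearMap ∘L
    ContinuousLinearMap.mul ℂ A
  act_mul a b ξ := ULift.ext _ _ (mul_assoc a b ξ.down)
  norm_act_le a ξ := norm_mul_le a ξ.down

theorem uliftSelfModule_isEssential.{u₁} [CompleteSpace A] (hl : IsBoundedApproxIdentity l) :
    (uliftSelfModule.{u₁} A).IsEssential := fun ξ => by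
  obtain ⟨a, y, h⟩ := exists_mul_eq_of_isBoundedApproxIdentity hl ξ.down
  exact ⟨a, ⟨y⟩, ULift.ext _ _ h⟩

theorem exists_coefficient_uliftSelfModule_eq.{u₁} (hl : IsBoundedApproxIdentity l)
    (Φ : StrongDual ℂ A) : ∃ m w, coefficient (uliftSelfModule.{u₁} A) m w = Φ :=
  exists_coefficient_eq hl _
    (ContinuousLinearEquiv.ulift (R₁ := ℂ) (M₁ := A)).toContinuousLinearMap
    (ContinuousLinearEquiv.ulift (R₁ := ℂ) (M₁ := A)).symm.toContinuousLinearMap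
    (fun _ _ => rfl) Φ

theorem exists_coefficient_selfModule_eq (hl : IsBoundedApproxIdentity l)
    (Φ : StrongDual ℂ A) : ∃ m w, coefficient (selfModule A) m w = Φ :=
  exists_coefficient_eq hl _ (.id ℂ A) (.id ℂ A) (fun _ _ => rfl) Φ

end Modules

/-! ### The module `L¹(G, A)`. -/

section CovariantAct

variable {A : Type*} [NonUnitalNormedRing A] [NormedSpace ℂ A] {G : Type*} [MeasurableSpace G]
  (μ : Measure G) [Group G] [TopologicalSpace G] [IsTopologicalGroup G] [BorelSpace G]
  [μ.IsMulLeftInvariant]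

theorem coeFn_covariantAct (β : G → A →L[ℂ] A) (x : G) (f : Lp A 1 μ) :
    covariantAct μ β x f =ᵐ[μ] fun t => β x (f (x⁻¹ * t)) := by
  filter_upwards [ContinuousLinearMap.coeFn_compLp (β x)
    (Lp.compMeasurePreserving (fun t : G => x⁻¹ * t) (measurePreserving_mul_left μ x⁻¹) f),
    Lp.coeFn_compMeasurePreserving f (measurePreserving_mul_left μ x⁻¹)] with t h1 h2
  refine h1.trans ?_
  rw [h2]
  rfl

end CovariantAct

section Covariant

variable {A : Type*} [NonUnitalNormedRing A] [NormedSpace ℂ A]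
  [IsScalarTower ℂ A A] [SMulCommClass ℂ A A] {G : Type*} [MeasurableSpace G] (μ : Measure G)

theorem coeFn_covariantModule_act (a : A) (f : Lp A 1 μ) :
    (covariantModule μ).act a f =ᵐ[μ] fun t => a * f t :=
  ContinuousLinearMap.coeFn_compLp (ContinuousLinearMap.mul ℂ A a) f

/-- `A` is a retract of `L¹(G, A)`: embed `b` as `μ(K)⁻¹ 1_K b` and return by integrating, which
commutes with left multiplication. -/
theorem exists_coefficient_covariantModule_eq [CompleteSpace A] {l : Filter A}
    (hl : IsBoundedApproxIdentity l) {K : Set G} (hK : MeasurableSet K) (hK0 : μ K ≠ 0)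
    (hK1 : μ K ≠ ⊤) (Φ : StrongDual ℂ A) :
    ∃ m w, coefficient (covariantModule (A := A) μ) m w = Φ := by
  let s : A →L[ℂ] Lp A 1 μ := LinearMap.mkContinuous
    { toFun := fun b => indicatorConstLp 1 hK hK1 b
      map_add' := fun b c => (indicatorConstLp_add ..).symm
      map_smul' := fun c b => by
        apply Lp.ext
        filter_upwards [indicatorConstLp_coeFn (p := 1) (hs := hK) (hμs := hK1) (c := c • b),
          indicatorConstLp_coeFn (p := 1) (hs := hK) (hμs := hK1) (c := b),
          Lp.coeFn_smul c (indicatorConstLp 1 hK hK1 b)] with t h1 h2 h3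
        rw [h1, RingHom.id_apply, h3, Pi.smul_apply, h2]
        by_cases ht : t ∈ K <;> simp [ht] } (μ.real K) (fun b => by
      rw [mul_comm]
      simpa using! norm_indicatorConstLp_le (p := 1) (hs := hK) (hμs := hK1) (c := b))
  let q : Lp A 1 μ →L[ℂ] A := L1.integralCLM' ℂ
  have hq : ∀ f : Lp A 1 μ, q f = ∫ t, f t ∂μ := fun f => by
    rw [← L1.integral_eq_integral, L1.integral_eq' ℂ]
  have hr : ((μ.real K : ℝ) : ℂ) ≠ 0 := by
    exact_mod_cast (ENNReal.toReal_pos hK0 hK1).ne'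
  refine exists_coefficient_eq hl _ q (((μ.real K : ℝ) : ℂ)⁻¹ • s) (fun a b => ?_) Φ
  have h1 : q ((covariantModule μ).act a (s b)) = (μ.real K : ℂ) • (a * b) := by
    rw [hq]
    refine (ContinuousLinearMap.integral_compLp (ContinuousLinearMap.mul ℂ A a) (s b)).trans ?_
    rw [ContinuousLinearMap.integral_comp_L1_comm]
    change a * ∫ t, indicatorConstLp 1 hK hK1 b t ∂μ = _
    rw [integral_indicatorConstLp, ← mul_smul_comm]
    rfl
  rw [smul_apply, map_smul, map_smul, h1, inv_smul_smul₀ hr]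

variable [Group G] [TopologicalSpace G] [IsTopologicalGroup G] [BorelSpace G]
  [μ.IsMulLeftInvariant]

theorem covariantAct_conj {β : G → A →L[ℂ] A} (hmul : ∀ x a b, β x (a * b) = β x a * β x b)
    (hinv : ∀ x a, β x (β x⁻¹ a) = a) (x : G) (a : A) (f : Lp A 1 μ) :
    covariantAct μ β x ((covariantModule μ).act a (covariantAct μ β x⁻¹ f))
      = (covariantModule μ).act (β x a) f := by
  apply Lp.ext
  -- Almost-everywhere identities must be transported along `t ↦ x⁻¹ t` before they can be
  -- substituted.
  have hx := (measurePreserving_mul_left μ x⁻¹).quasiMeasurePreserving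
  filter_upwards [coeFn_covariantAct μ β x ((covariantModule μ).act a (covariantAct μ β x⁻¹ f)),
    hx.ae (coeFn_covariantModule_act μ a (covariantAct μ β x⁻¹ f)),
    hx.ae (coeFn_covariantAct μ β x⁻¹ f),
    coeFn_covariantModule_act μ (β x a) f] with t h1 h2 h3 h4
  rw [h1, h2, h3, h4, hmul, hinv, inv_inv, mul_inv_cancel_left]

end Covariant

end VNAmenability

theorem theorem4p6
    {H : Type z} [NormedAddCommGroup H] [InnerProductSpace ℂ H] [CompleteSpace H]
    (M : VonNeumannAlgebra H)
    {G : Type v} [Group G] [TopologicalSpace G] [IsTopologicalGroup G]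
    [LocallyCompactSpace G] [T2Space G] [MeasurableSpace G] [BorelSpace G]
    (μ : Measure G) [μ.IsHaarMeasure] [μ.Regular]
    (α : G →* (M.toStarSubalgebra ≃⋆ₐ[ℂ] M.toStarSubalgebra))
    (hα : VNAmenability.IsWeakStarContinuousAction M α)
    -- the predual `A = M_*` with a Banach algebra multiplication
    {A : Type u} [NonUnitalNormedRing A] [NormedSpace ℂ A]
    [IsScalarTower ℂ A A] [SMulCommClass ℂ A A] [CompleteSpace A]
    (j : A ≃ₗᵢ[ℂ] VNAmenability.Predual M)
    -- each `β_x = (α_{x⁻¹})_*` is an algebra automorphism of `A`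
    (hβ : ∀ x : G, Function.Bijective (VNAmenability.predualAction j α x) ∧
      ∀ a b : A, VNAmenability.predualAction j α x (a * b) =
        VNAmenability.predualAction j α x a * VNAmenability.predualAction j α x b)
    -- a bounded approximate identity, and the inner action
    (l : Filter A) (hl : VNAmenability.IsBoundedApproxIdentity l)
    (γ : G →* 𝓜(ℂ, A))
    (hγ : VNAmenability.IsInnerVia (VNAmenability.predualAction j α) γ) :
    List.TFAE [
      VNAmenability.IsGAmenable M α,
      ∀ (X : Type (max u w)) [NormedAddCommGroup X] [NormedSpace ℂ X] [CompleteSpace X]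
        (π : VNAmenability.LeftBanachModule A X) (hπ : π.IsEssential),
        VNAmenability.HasFixedPoint j π
          (fun x : G => VNAmenability.multiplierAct hl hπ (γ x)),
      VNAmenability.HasFixedPoint j (VNAmenability.selfModule A) (fun x : G => (γ x).fst),
      VNAmenability.HasFixedPoint j (VNAmenability.covariantModule μ)
        (VNAmenability.covariantAct μ (VNAmenability.predualAction j α))] := by
  have hbij : ∀ x : G, Function.Bijective (VNAmenability.predualAction j α x) := fun x => (hβ x).1
  have hself : ∀ (x : G) (a b : A), (γ x).fst ((VNAmenability.selfModule A).act a ((γ x⁻¹).fst b))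
      = (VNAmenability.selfModule A).act (VNAmenability.predualAction j α x a) b :=
    hγ.apply_mul hl
  have hcov := VNAmenability.covariantAct_conj μ (fun x => (hβ x).2)
    (VNAmenability.predualAction_predualAction_inv j α hbij)
  tfae_have 1 → 2 := fun h X _ _ _ π hπ =>
    VNAmenability.hasFixedPoint_of_isGAmenable hbij π _ (hγ.multiplierAct_conj hl hπ) h
  tfae_have 1 → 3 := VNAmenability.hasFixedPoint_of_isGAmenable hbij _ _ hself
  tfae_have 1 → 4 := VNAmenability.hasFixedPoint_of_isGAmenable hbij _ _ hcov
  tfae_have 2 → 1 := by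
    intro h
    -- `A` lives in `Type u`, whereas (ii) ranges over modules in `Type (max u w)`.
    have hess : (VNAmenability.uliftSelfModule A :
        VNAmenability.LeftBanachModule A (ULift.{max u w} A)).IsEssential :=
      VNAmenability.uliftSelfModule_isEssential hl
    exact VNAmenability.isGAmenable_of_hasFixedPoint hbij _ _ (hγ.multiplierAct_conj hl hess)
      (VNAmenability.exists_coefficient_uliftSelfModule_eq hl) (h _ _ hess)
  tfae_have 3 → 1 := VNAmenability.isGAmenable_of_hasFixedPoint hbij _ _ hself
    (VNAmenability.exists_coefficient_selfModule_eq hl)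
  tfae_have 4 → 1 := by
    obtain ⟨K, hK, hK1⟩ := exists_compact_mem_nhds (1 : G)
    have hpos : μ (closure K) ≠ 0 :=
      (Measure.measure_pos_of_mem_nhds μ (mem_of_superset hK1 subset_closure)).ne'
    exact VNAmenability.isGAmenable_of_hasFixedPoint hbij _ _ hcov
      (VNAmenability.exists_coefficient_covariantModule_eq μ hl isClosed_closure.measurableSet
        hpos hK.closure.measure_lt_top.ne)
  tfae_finish
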